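/- For a finite simple graph $G$ on $n$ vertices with adjacency matrix $A$ and diagonal matrix of vertex degrees $D$, let $q_1,\dots,q_n$ be the eigenvalues (with multiplicity) of the signless Laplacian matrix $Q=D+A$, and let $\mathrm{SLEE}(G)=\sum_{i=1}^n e^{q_i}$ be the signless Laplacian Estrada index of $G$. Let $n,d$ be integers with $2<d<n-1$. Let $H_{d,1}$ be the graph on $n$ vertices obtained from the disjoint union of a path $v_0v_1\cdots v_d$ and a complete graph $K_{n-d-1}$ by joining every vertex of $K_{n-d-1}$ to exactly the three path vertices $v_{\lceil d/2\rceil-1}$, $v_{\lceil d/2\rceil}$ and $v_{\lceil d/2\rceil+1}$. Then $H_{d,1}$ is, up to isomorphism, the unique graph with maximum $\mathrm{SLEE}$ among all connected simple graphs on $n$ vertices with diameter $d$. That is, a graph $G$ on $n$ vertices is connected with diameter $d$ and satisfies $\mathrm{SLEE}(G')\le \mathrm{SLEE}(G)$ for every connected graph $G'$ on the same vertex set with diameter $d$ if and only if $G$ is isomorphic to $H_{d,1}$. -/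

import Mathlib

namespace SimpleGraph

open Classical in
/-- The signless Laplacian matrix `Q = D + A` of a finite simple graph. -/
noncomputable def signlessLapMatrix {V : Type*} [Fintype V] (G : SimpleGraph V) :
    Matrix V V ℝ :=
  G.degMatrix ℝ + G.adjMatrix ℝ

theorem isHermitian_signlessLapMatrix {V : Type*} [Fintype V] (G : SimpleGraph V) :
    G.signlessLapMatrix.IsHermitian := by
  classical
  unfold signlessLapMatrix
  exact (G.isHermitian_degMatrix ℝ).add (G.isHermitian_adjMatrix ℝ)

open Classical in
/-- The signless Laplacian Estrada index `SLEE(G) = ∑ᵢ exp(qᵢ)`, where the `qᵢ` are the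
eigenvalues of the signless Laplacian matrix, counted with multiplicity. -/
noncomputable def SLEE {V : Type*} [Fintype V] (G : SimpleGraph V) : ℝ :=
  ∑ i : V, Real.exp (G.isHermitian_signlessLapMatrix.eigenvalues i)

/-- The graph `H_{d,1}` on `n` vertices: the path `v_0 v_1 … v_d` (vertices `Sum.inl i`) and a
clique `K_{n-d-1}` (vertices `Sum.inr a`), where every clique vertex is joined to exactly the
three path vertices with indices `⌈d/2⌉ - 1`, `⌈d/2⌉` and `⌈d/2⌉ + 1`.
Here `⌈d/2⌉` is written `(d + 1) / 2`, with division of natural numbers. -/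
def pathCliqueGraph (n d : ℕ) : SimpleGraph (Fin (d + 1) ⊕ Fin (n - d - 1)) where
  Adj
    | Sum.inl i, Sum.inl j => (pathGraph (d + 1)).Adj i j
    | Sum.inr a, Sum.inr b => a ≠ b
    | Sum.inl i, Sum.inr _ =>
        (i : ℕ) + 1 = (d + 1) / 2 ∨ (i : ℕ) = (d + 1) / 2 ∨ (i : ℕ) = (d + 1) / 2 + 1
    | Sum.inr _, Sum.inl i =>
        (i : ℕ) + 1 = (d + 1) / 2 ∨ (i : ℕ) = (d + 1) / 2 ∨ (i : ℕ) = (d + 1) / 2 + 1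
  symm := ⟨by
    rintro (i | a) (j | b) h
    · exact h.symm
    · exact h
    · exact h
    · exact Ne.symm h⟩
  loopless := ⟨by
    rintro (i | a) h
    · exact (pathGraph (d + 1)).loopless.irrefl i h
    · exact h rfl⟩

end SimpleGraph

/-! Expanding the exponential gives `SLEE G = ∑ tr(Q^k) / k!`, so graphs can be compared through the
traces `tr(Q^k)`. Adding edges strictly increases `SLEE`. A connected graph of diameter `d` lies
inside the graph that joins all vertices whose distances from an end of a diametral path differ by
at most one, and this graph again has diameter `d`. A maximal graph is therefore a `levelGraph`, and
only the sizes of its levels remain to be determined.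

Suppose that level `q` is in the upper half, has several vertices, and all higher levels are
singletons. Lowering all of level `q` but one vertex to level `q - 1` replaces their edges to level
`q + 1` by edges to level `q - 2`. These two ends are mirror images under the reflection `i ↦ 2q - 1
- i` of a chosen path. In the basis of symmetric and antisymmetric combinations of mirror pairs,
together with the remaining unit vectors, the half sum `P` and half difference `R` of the new and
old matrices `Q'` and `Q` are both entrywise nonnegative (`fold_add_nonneg`, `fold_sub_nonneg`). As
`Q' = P + R` and `Q = P - R` there, `tr(Q^k) ≤ tr(Q'^k)` for all `k`. The inequality is strict for
some `k` if a closed walk uses `R` exactly once, and such a walk exists when the reflection fails to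
preserve degrees somewhere (`IsFoldMove.SLEE_lt`).

Applying this from both ends leaves a single level that can be nontrivial, the middle one, up to
reversal; that graph is `pathCliqueGraph`. The converse follows because a maximum over finitely many
graphs exists and is isomorphic to it. -/

namespace Matrix

/-! ### Traces of powers of `P + R` and `P - R` for nonnegative `P` and `R`. -/

variable {V : Type*} [Fintype V] [DecidableEq V]

theorem IsHermitian.trace_pow_eq_sum_eigenvalues_pow {A : Matrix V V ℝ} (hA : A.IsHermitian)
    (k : ℕ) : (A ^ k).trace = ∑ i, hA.eigenvalues i ^ k := by
  conv_lhs => rw [hA.spectral_theorem, ← map_pow, Unitary.conjStarAlgAut_apply, trace_mul_cycle,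
    Unitary.coe_star_mul_self, one_mul, diagonal_pow, trace_diagonal]
  simp

theorem pow_apply_le_pow_apply {P N : Matrix V V ℝ} (hP : ∀ i j, 0 ≤ P i j)
    (h : ∀ i j, P i j ≤ N i j) (k : ℕ) (i j : V) : (P ^ k) i j ≤ (N ^ k) i j := by
  induction k generalizing j with
  | zero => simp
  | succ k ih =>
    rw [pow_succ, mul_apply, pow_succ, mul_apply]
    exact Finset.sum_le_sum fun m _ => mul_le_mul (ih m) (h m j) (hP m j)
      ((pow_apply_nonneg hP k i m).trans (ih m))

/-- The even and odd parts of `(P + R) ^ k` with respect to the sign of `R`. -/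
theorem exists_even_odd_parts {P R : Matrix V V ℝ} (hP : ∀ i j, 0 ≤ P i j)
    (hR : ∀ i j, 0 ≤ R i j) (k : ℕ) :
    ∃ E O : Matrix V V ℝ, (P + R) ^ k = E + O ∧ (P - R) ^ k = E - O ∧
      (∀ i j, (P ^ k) i j ≤ E i j) ∧ (∀ i j, 0 ≤ O i j) := by
  induction k with
  | zero => exact ⟨1, 0, by simp, by simp, by simp, by simp⟩
  | succ k ih =>
    obtain ⟨E, O, h1, h2, hE, hO⟩ := ih
    have hE0 : ∀ i j, 0 ≤ E i j := fun i j => (pow_apply_nonneg hP k i j).trans (hE i j)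
    -- A further factor `R` switches the parity and a further factor `P` keeps it.
    refine ⟨E * P + O * R, E * R + O * P, ?_, ?_, fun i j => ?_, fun i j => ?_⟩
    · rw [pow_succ, h1]; noncomm_ring
    · rw [pow_succ, h2]; noncomm_ring
    · rw [pow_succ, mul_apply, add_apply, mul_apply, mul_apply]
      refine le_add_of_le_of_nonneg
        (Finset.sum_le_sum fun m _ => mul_le_mul_of_nonneg_right (hE i m) (hP m j))
        (Finset.sum_nonneg fun m _ => mul_nonneg (hO i m) (hR m j))
    · rw [add_apply, mul_apply, mul_apply]
      exact add_nonneg (Finset.sum_nonneg fun m _ => mul_nonneg (hE0 i m) (hR m j))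
        (Finset.sum_nonneg fun m _ => mul_nonneg (hO i m) (hP m j))

theorem trace_sub_pow_le_trace_add_pow {P R : Matrix V V ℝ} (hP : ∀ i j, 0 ≤ P i j)
    (hR : ∀ i j, 0 ≤ R i j) (k : ℕ) : ((P - R) ^ k).trace ≤ ((P + R) ^ k).trace := by
  obtain ⟨E, O, h1, h2, -, hO⟩ := exists_even_odd_parts hP hR k
  have : 0 ≤ O.trace := Finset.sum_nonneg fun i _ => hO i i
  rw [h1, h2, trace_add, trace_sub]
  linarith

theorem exists_pow_apply_pos {P : Matrix V V ℝ} (hP : ∀ i j, 0 ≤ P i j) {u v : V}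
    (h : Relation.ReflTransGen (fun i j => 0 < P i j) u v) : ∃ k, 0 < (P ^ k) u v := by
  induction h with
  | refl => exact ⟨0, by simp⟩
  | tail _ hbc ih =>
    obtain ⟨k, hk⟩ := ih
    refine ⟨k + 1, ?_⟩
    rw [pow_succ, mul_apply]
    exact (mul_pos hk hbc).trans_le (Finset.single_le_sum
      (f := fun m => (P ^ k) u m * P m _)
      (fun m _ => mul_nonneg (pow_apply_nonneg hP k u m) (hP m _)) (Finset.mem_univ _))

/-- The two traces differ by twice the trace of the odd part. A closed walk made of `P`-steps from
`u` to `v` and one `R`-step back contributes positively to that part. -/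
theorem exists_trace_sub_pow_lt_trace_add_pow {P R : Matrix V V ℝ} (hP : ∀ i j, 0 ≤ P i j)
    (hR : ∀ i j, 0 ≤ R i j) {u v : V}
    (h : Relation.ReflTransGen (fun i j => 0 < P i j) u v) (hvu : 0 < R v u) :
    ∃ k, ((P - R) ^ k).trace < ((P + R) ^ k).trace := by
  obtain ⟨k, hk⟩ := exists_pow_apply_pos hP h
  obtain ⟨E, O, h1, h2, hE, hO⟩ := exists_even_odd_parts hP hR k
  refine ⟨k + 1, ?_⟩
  rw [pow_succ, pow_succ, h1, h2]
  have hE0 : ∀ i j, 0 ≤ E i j := fun i j => (pow_apply_nonneg hP k i j).trans (hE i j)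
  have hER : 0 < (E * R).trace := by
    refine Finset.sum_pos' (fun i _ => ?_) ⟨u, Finset.mem_univ _, ?_⟩
    · rw [diag_apply, mul_apply]
      exact Finset.sum_nonneg fun m _ => mul_nonneg (hE0 i m) (hR m i)
    · rw [diag_apply, mul_apply]
      exact (mul_pos (hk.trans_le (hE u v)) hvu).trans_le (Finset.single_le_sum
        (f := fun m => E u m * R m u)
        (fun m _ => mul_nonneg (hE0 u m) (hR m u)) (Finset.mem_univ _))
  have hOP : 0 ≤ (O * P).trace := by
    refine Finset.sum_nonneg fun i _ => ?_
    rw [diag_apply, mul_apply]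
    exact Finset.sum_nonneg fun m _ => mul_nonneg (hO i m) (hP m i)
  have e1 : (E + O) * (P + R) = E * P + O * R + (E * R + O * P) := by noncomm_ring
  have e2 : (E - O) * (P - R) = E * P + O * R - (E * R + O * P) := by noncomm_ring
  rw [e1, e2, trace_add, trace_sub, trace_add (E * R)]
  linarith

end Matrix

/-! ### The signless Laplacian and its Estrada index through traces of powers. -/

namespace SimpleGraph

variable {V : Type*}

open Classical in
/-- The adjacency relation as a real-valued indicator. -/
noncomputable def adjInd (G : SimpleGraph V) (u v : V) : ℝ := if G.Adj u v then 1 else 0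

theorem adjInd_nonneg (G : SimpleGraph V) (u v : V) : 0 ≤ G.adjInd u v := by
  unfold adjInd; split_ifs <;> norm_num

theorem adjInd_of_adj {G : SimpleGraph V} {u v : V} (h : G.Adj u v) : G.adjInd u v = 1 := by
  simp [adjInd, h]

theorem adjInd_of_not_adj {G : SimpleGraph V} {u v : V} (h : ¬ G.Adj u v) :
    G.adjInd u v = 0 := by
  simp [adjInd, h]

theorem adjInd_congr {W : Type*} {G : SimpleGraph V} {H : SimpleGraph W} {u v : V} {x y : W}
    (h : G.Adj u v ↔ H.Adj x y) : G.adjInd u v = H.adjInd x y := by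
  by_cases huv : G.Adj u v
  · rw [adjInd_of_adj huv, adjInd_of_adj (h.mp huv)]
  · rw [adjInd_of_not_adj huv, adjInd_of_not_adj fun hh => huv (h.mpr hh)]

theorem adjInd_comm (G : SimpleGraph V) (u v : V) : G.adjInd u v = G.adjInd v u :=
  adjInd_congr (G.adj_comm u v)

theorem adjInd_mono {G G' : SimpleGraph V} (h : G ≤ G') (u v : V) :
    G.adjInd u v ≤ G'.adjInd u v := by
  by_cases huv : G.Adj u v
  · rw [adjInd_of_adj huv, adjInd_of_adj (h huv)]
  · rw [adjInd_of_not_adj huv]; exact G'.adjInd_nonneg u v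

variable [Fintype V]

theorem signlessLapMatrix_apply_self (G : SimpleGraph V) (u : V) :
    G.signlessLapMatrix u u = ∑ w, G.adjInd u w := by
  classical
  simp only [signlessLapMatrix, degMatrix, Matrix.add_apply, Matrix.diagonal_apply_eq,
    adjMatrix_apply, SimpleGraph.irrefl, if_false, add_zero, adjInd]
  rw [Finset.sum_boole, ← card_neighborFinset_eq_degree]
  congr 2
  ext w
  simp

theorem signlessLapMatrix_apply_ne (G : SimpleGraph V) {u v : V} (h : u ≠ v) :
    G.signlessLapMatrix u v = G.adjInd u v := by
  classical
  simp [signlessLapMatrix, degMatrix, adjMatrix_apply, adjInd, h]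

theorem signlessLapMatrix_comm (G : SimpleGraph V) (u v : V) :
    G.signlessLapMatrix u v = G.signlessLapMatrix v u := by
  rcases eq_or_ne u v with rfl | h
  · rfl
  · rw [signlessLapMatrix_apply_ne _ h, signlessLapMatrix_apply_ne _ h.symm, adjInd_comm]

theorem signlessLapMatrix_nonneg (G : SimpleGraph V) (u v : V) :
    0 ≤ G.signlessLapMatrix u v := by
  rcases eq_or_ne u v with rfl | h
  · rw [signlessLapMatrix_apply_self]; exact Finset.sum_nonneg fun w _ => G.adjInd_nonneg u w
  · rw [signlessLapMatrix_apply_ne _ h]; exact G.adjInd_nonneg u v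

theorem adjInd_le_signlessLapMatrix (G : SimpleGraph V) (u v : V) :
    G.adjInd u v ≤ G.signlessLapMatrix u u := by
  rw [signlessLapMatrix_apply_self]
  exact Finset.single_le_sum (f := fun w => G.adjInd u w) (fun w _ => G.adjInd_nonneg u w)
    (Finset.mem_univ v)

theorem hasSum_SLEE [DecidableEq V] (G : SimpleGraph V) :
    HasSum (fun k : ℕ => (G.signlessLapMatrix ^ k).trace / (k.factorial : ℝ)) G.SLEE := by
  classical
  have h : ∀ k : ℕ, (G.signlessLapMatrix ^ k).trace / (k.factorial : ℝ) =
      ∑ i, G.isHermitian_signlessLapMatrix.eigenvalues i ^ k / (k.factorial : ℝ) := fun k => by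
    rw [← Finset.sum_div, ← G.isHermitian_signlessLapMatrix.trace_pow_eq_sum_eigenvalues_pow]
  simp_rw [h]
  unfold SLEE
  refine hasSum_sum fun i _ => ?_
  rw [Real.exp_eq_exp_ℝ]
  exact NormedSpace.expSeries_div_hasSum_exp _

theorem SLEE_lt_of_trace_pow_le [DecidableEq V] {G G' : SimpleGraph V}
    (h : ∀ k, (G.signlessLapMatrix ^ k).trace ≤ (G'.signlessLapMatrix ^ k).trace)
    (hlt : ∃ k, (G.signlessLapMatrix ^ k).trace < (G'.signlessLapMatrix ^ k).trace) :
    G.SLEE < G'.SLEE := by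
  obtain ⟨k, hk⟩ := hlt
  have hpos : ∀ k : ℕ, (0 : ℝ) < k.factorial := fun k => by positivity
  exact hasSum_lt (fun k => div_le_div_of_nonneg_right (h k) (hpos k).le)
    (div_lt_div_of_pos_right hk (hpos k)) G.hasSum_SLEE G'.hasSum_SLEE

/-- Powers of nonnegative matrices are monotone in the entries. Strictness already shows at `k = 1`,
where the trace is the sum of the degrees. -/
theorem SLEE_lt_of_lt {G G' : SimpleGraph V} (h : G < G') : G.SLEE < G'.SLEE := by
  classical
  have hle : ∀ i j, G.signlessLapMatrix i j ≤ G'.signlessLapMatrix i j := fun i j => by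
    rcases eq_or_ne i j with rfl | hij
    · rw [signlessLapMatrix_apply_self, signlessLapMatrix_apply_self]
      exact Finset.sum_le_sum fun w _ => adjInd_mono h.le i w
    · rw [signlessLapMatrix_apply_ne _ hij, signlessLapMatrix_apply_ne _ hij]
      exact adjInd_mono h.le i j
  refine SLEE_lt_of_trace_pow_le (fun k => Finset.sum_le_sum fun i _ =>
    Matrix.pow_apply_le_pow_apply G.signlessLapMatrix_nonneg hle k i i) ⟨1, ?_⟩
  rw [pow_one, pow_one]
  obtain ⟨u, v, huv, huv'⟩ : ∃ u v, G'.Adj u v ∧ ¬ G.Adj u v := by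
    by_contra! hcon
    exact h.not_ge fun u v huv => hcon u v huv
  refine Finset.sum_lt_sum (fun i _ => hle i i) ⟨u, Finset.mem_univ _, ?_⟩
  rw [Matrix.diag_apply, Matrix.diag_apply, signlessLapMatrix_apply_self,
    signlessLapMatrix_apply_self]
  refine Finset.sum_lt_sum (fun w _ => adjInd_mono h.le u w) ⟨v, Finset.mem_univ _, ?_⟩
  rw [adjInd_of_adj huv, adjInd_of_not_adj huv']
  norm_num

theorem SLEE_congr {W : Type*} [Fintype W] {G : SimpleGraph V} {H : SimpleGraph W}
    (e : G ≃g H) : G.SLEE = H.SLEE := by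
  classical
  have hmat : G.signlessLapMatrix = H.signlessLapMatrix.submatrix e e := by
    ext u v
    have hadj : ∀ u v, G.adjInd u v = H.adjInd (e u) (e v) := fun u v =>
      adjInd_congr e.map_adj_iff.symm
    rcases eq_or_ne u v with rfl | h
    · rw [Matrix.submatrix_apply, signlessLapMatrix_apply_self, signlessLapMatrix_apply_self,
        ← e.toEquiv.sum_comp]
      exact Finset.sum_congr rfl fun w _ => hadj u w
    · rw [Matrix.submatrix_apply, signlessLapMatrix_apply_ne _ h,
        signlessLapMatrix_apply_ne _ (e.injective.ne h), hadj]
  have hpow : ∀ k, (G.signlessLapMatrix ^ k).trace = (H.signlessLapMatrix ^ k).trace := fun k => by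
    have : G.signlessLapMatrix ^ k = (H.signlessLapMatrix ^ k).submatrix e e := by
      rw [hmat]
      exact (map_pow (Matrix.reindexAlgEquiv ℝ ℝ e.toEquiv.symm) H.signlessLapMatrix k).symm
    rw [this]
    exact e.toEquiv.sum_comp fun w => (H.signlessLapMatrix ^ k) w w
  refine G.hasSum_SLEE.unique ?_
  simp_rw [hpow]
  exact H.hasSum_SLEE

end SimpleGraph

/-! ### Change of basis to symmetric and antisymmetric combinations under a partial reflection. -/

namespace Matrix

/-- The coefficient of `e_v` in the basis vector attached to a vertex `v` of the given sign. -/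
noncomputable def foldSelf : SignType → ℝ
  | .zero => 1
  | .pos => 1
  | .neg => -1

/-- The coefficient of `e_{σ v}` in the basis vector attached to a vertex `v` of the given
sign. -/
noncomputable def foldMate : SignType → ℝ
  | .zero => 0
  | .pos => 1
  | .neg => 1

@[simp] theorem foldSelf_zero : foldSelf 0 = 1 := rfl
@[simp] theorem foldSelf_one : foldSelf 1 = 1 := rfl
@[simp] theorem foldSelf_neg_one : foldSelf (-1) = -1 := rfl
@[simp] theorem foldMate_zero : foldMate 0 = 0 := rfl
@[simp] theorem foldMate_one : foldMate 1 = 1 := rfl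
@[simp] theorem foldMate_neg_one : foldMate (-1) = 1 := rfl

variable {V : Type*} [Fintype V] [DecidableEq V]

/-- The change of basis to the vectors `e_l + e_{σ l}` (for `ε l = 1`), `e_{σ r} - e_r`
(for `ε r = -1`) and `e_f` (for `ε f = 0`). -/
noncomputable def foldBasis (σ : V → V) (ε : V → SignType) : Matrix V V ℝ :=
  of fun w v => (if w = v then foldSelf (ε v) else 0) + if w = σ v then foldMate (ε v) else 0

/-- The dual basis of `foldBasis`. -/
noncomputable def foldDual (σ : V → V) (ε : V → SignType) : Matrix V V ℝ :=
  of fun u w => (if w = u then foldSelf (ε u) / (1 + foldMate (ε u)) else 0) +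
    if w = σ u then foldMate (ε u) / (1 + foldMate (ε u)) else 0

/-- The matrix `X` written in the basis `foldBasis`. -/
noncomputable def fold (σ : V → V) (ε : V → SignType) (X : Matrix V V ℝ) : Matrix V V ℝ :=
  foldDual σ ε * X * foldBasis σ ε

variable {σ : V → V} {ε : V → SignType}

theorem foldDual_mul_apply (X : Matrix V V ℝ) (u v : V) :
    (foldDual σ ε * X) u v = foldSelf (ε u) / (1 + foldMate (ε u)) * X u v +
      foldMate (ε u) / (1 + foldMate (ε u)) * X (σ u) v := by
  simp [mul_apply, foldDual, add_mul, Finset.sum_add_distrib]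

theorem mul_foldBasis_apply (X : Matrix V V ℝ) (u v : V) :
    (X * foldBasis σ ε) u v = X u v * foldSelf (ε v) + X u (σ v) * foldMate (ε v) := by
  simp [mul_apply, foldBasis, mul_add, Finset.sum_add_distrib]

theorem fold_apply (X : Matrix V V ℝ) (u v : V) :
    fold σ ε X u v =
      (foldSelf (ε u) / (1 + foldMate (ε u)) * X u v +
        foldMate (ε u) / (1 + foldMate (ε u)) * X (σ u) v) * foldSelf (ε v) +
      (foldSelf (ε u) / (1 + foldMate (ε u)) * X u (σ v) +
        foldMate (ε u) / (1 + foldMate (ε u)) * X (σ u) (σ v)) * foldMate (ε v) := by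
  rw [fold, mul_foldBasis_apply, foldDual_mul_apply, foldDual_mul_apply]

theorem fold_add (X Y : Matrix V V ℝ) : fold σ ε (X + Y) = fold σ ε X + fold σ ε Y := by
  rw [fold, fold, fold, mul_add, add_mul]

theorem fold_sub (X Y : Matrix V V ℝ) : fold σ ε (X - Y) = fold σ ε X - fold σ ε Y := by
  rw [fold, fold, fold, mul_sub, sub_mul]

section Involution

variable (hσ : Function.Involutive σ) (hε : ∀ v, ε (σ v) = -ε v)
  (hfix : ∀ v, ε v = 0 → σ v = v)

include hσ hε hfix

theorem foldDual_mul_foldBasis : foldDual σ ε * foldBasis σ ε = 1 := by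
  ext u v
  rw [foldDual_mul_apply, foldBasis, of_apply, of_apply, one_apply]
  have h1 : σ u = σ v ↔ u = v := hσ.injective.eq_iff
  have h2 : σ u = v ↔ u = σ v := ⟨fun h => by rw [← h, hσ u], fun h => by rw [h, hσ v]⟩
  simp only [h1, h2]
  by_cases huv : u = v
  · subst huv
    -- A fixed point of `σ` satisfies `ε u = -ε u`, hence has sign zero.
    by_cases hu : u = σ u
    · have : ε u = 0 := by
        have := hε u
        rw [← hu] at this
        revert this
        generalize ε u = s
        revert s
        decide
      simp [← hu, this]
    · rcases SignType.trichotomy (ε u) with h | h | h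
      · simp [hu, h]; norm_num
      · exact absurd (hfix u h).symm hu
      · simp [hu, h]; norm_num
  · by_cases hu : u = σ v
    · subst hu
      rcases SignType.trichotomy (ε v) with h | h | h
      · simp [huv, h, hε]
      · exact absurd (hfix v h) huv
      · simp [huv, h, hε]; norm_num
    · simp [huv, hu]

theorem trace_fold_pow (X : Matrix V V ℝ) (k : ℕ) : (fold σ ε X ^ k).trace = (X ^ k).trace := by
  have h := foldDual_mul_foldBasis hσ hε hfix
  have h' : foldBasis σ ε * foldDual σ ε = 1 := mul_eq_one_comm.mp h
  have : fold σ ε X ^ k = foldDual σ ε * X ^ k * foldBasis σ ε := by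
    induction k with
    | zero => simp [h]
    | succ k ih =>
      rw [pow_succ, ih, fold, pow_succ]
      simp only [Matrix.mul_assoc]
      rw [← Matrix.mul_assoc (foldBasis σ ε), h', Matrix.one_mul]
  rw [this, trace_mul_cycle, h', Matrix.one_mul]

-- For a pair `l`, `l'` of positive sign, the four entries of `fold` are, up to a factor `1/2`, the
-- sum of the entries of the block of `X` on `{l, σ l} × {l', σ l'}` with signs. `hadd` covers
-- symmetric-symmetric and antisymmetric-antisymmetric, and `hsub` the two mixed ones. With a fixed
-- vertex only `X f l ± X f (σ l)` occurs.
omit hfix in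
theorem fold_nonneg {X : Matrix V V ℝ} (hX : ∀ u v, X u v = X v u)
    (h00 : ∀ f g, ε f = 0 → ε g = 0 → 0 ≤ X f g)
    (h01 : ∀ f l, ε f = 0 → ε l = 1 → |X f (σ l)| ≤ X f l)
    (hadd : ∀ l l', ε l = 1 → ε l' = 1 →
      |X l (σ l') + X (σ l) l'| ≤ X l l' + X (σ l) (σ l'))
    (hsub : ∀ l l', ε l = 1 → ε l' = 1 →
      |X l (σ l') - X (σ l) l'| ≤ X l l' - X (σ l) (σ l')) (u v : V) :
    0 ≤ fold σ ε X u v := by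
  have hneg : ∀ {v}, ε v = -1 → ε (σ v) = 1 := fun {v} h => by rw [hε, h]; rfl
  rw [fold_apply]
  rcases SignType.trichotomy (ε u) with hu | hu | hu <;>
    rcases SignType.trichotomy (ε v) with hv | hv | hv <;>
    simp only [hu, hv, foldSelf_zero, foldSelf_one, foldSelf_neg_one, foldMate_zero,
      foldMate_one, foldMate_neg_one]
  · have h1 := abs_le.mp (hadd _ _ (hneg hu) (hneg hv))
    have h2 := abs_le.mp (hsub _ _ (hneg hu) (hneg hv))
    rw [hσ, hσ] at h1 h2
    linarith [h1.1, h1.2, h2.1, h2.2]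
  · have h1 := abs_le.mp (h01 _ _ hv (hneg hu))
    rw [hσ, hX v, hX v] at h1
    linarith [h1.1, h1.2]
  · have h1 := abs_le.mp (hadd _ _ (hneg hu) hv)
    have h2 := abs_le.mp (hsub _ _ (hneg hu) hv)
    rw [hσ] at h1 h2
    linarith [h1.1, h1.2, h2.1, h2.2]
  · have h1 := abs_le.mp (h01 _ _ hu (hneg hv))
    rw [hσ] at h1
    linarith [h1.1, h1.2]
  · linarith [h00 _ _ hu hv]
  · have h1 := abs_le.mp (h01 _ _ hu hv)
    linarith [h1.1, h1.2]
  · have h1 := abs_le.mp (hadd _ _ hu (hneg hv))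
    have h2 := abs_le.mp (hsub _ _ hu (hneg hv))
    rw [hσ] at h1 h2
    linarith [h1.1, h1.2, h2.1, h2.2]
  · have h1 := abs_le.mp (h01 _ _ hv hu)
    rw [hX v, hX v] at h1
    linarith [h1.1, h1.2]
  · have h1 := abs_le.mp (hadd _ _ hu hv)
    have h2 := abs_le.mp (hsub _ _ hu hv)
    linarith [h1.1, h1.2, h2.1, h2.2]

end Involution

end Matrix

/-! ### Fold moves and their effect on the Estrada index. -/

namespace SimpleGraph

variable {V : Type*}

/-- `G'` is obtained from `G` by moving edges along the partial reflection `σ`, which exchanges a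
part `ε = 1` of the graph with a smaller part `ε = -1` and fixes the vertices with `ε = 0`:
some fixed vertices lose an edge to the small part and gain the reflected edge. -/
structure IsFoldMove (σ : V → V) (ε : V → SignType) (G G' : SimpleGraph V) : Prop where
  involutive : Function.Involutive σ
  sign : ∀ v, ε (σ v) = -ε v
  fixed : ∀ v, ε v = 0 → σ v = v
  adj_of_fixed : ∀ f g, ε f = 0 → ε g = 0 → G.Adj f g → G'.Adj f g
  adj_mixed : ∀ f l, ε f = 0 → ε l = 1 →
    (¬ G.Adj f l ∧ G'.Adj f l ∧ G.Adj f (σ l) ∧ ¬ G'.Adj f (σ l)) ∨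
    ((G.Adj f l ↔ G'.Adj f l) ∧ (G.Adj f (σ l) ↔ G'.Adj f (σ l)) ∧ (G.Adj f (σ l) → G.Adj f l))
  adj_moved : ∀ u v, ε u ≠ 0 → ε v ≠ 0 → (G.Adj u v ↔ G'.Adj u v)
  adj_reflect : ∀ l l', ε l = 1 → ε l' = 1 → G.Adj (σ l) (σ l') → G.Adj l l'
  not_adj_cross : ∀ l l', ε l = 1 → ε l' = 1 → l ≠ l' → ¬ G.Adj l (σ l')

namespace IsFoldMove

variable {σ : V → V} {ε : V → SignType} {G G' : SimpleGraph V}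

theorem abs_sub_adjInd_le (h : IsFoldMove σ ε G G') {f l : V} (hf : ε f = 0) (hl : ε l = 1) :
    |G'.adjInd f (σ l) - G.adjInd f (σ l)| ≤ G'.adjInd f l - G.adjInd f l := by
  rcases h.adj_mixed f l hf hl with ⟨h1, h2, h3, h4⟩ | ⟨h1, h2, -⟩
  · rw [adjInd_of_not_adj h1, adjInd_of_adj h2, adjInd_of_adj h3, adjInd_of_not_adj h4]
    norm_num
  · rw [adjInd_congr h1, adjInd_congr h2]
    simp

theorem add_adjInd_le (h : IsFoldMove σ ε G G') {f l : V} (hf : ε f = 0) (hl : ε l = 1) :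
    G'.adjInd f (σ l) + G.adjInd f (σ l) ≤ G'.adjInd f l + G.adjInd f l := by
  rcases h.adj_mixed f l hf hl with ⟨h1, h2, h3, h4⟩ | ⟨h1, h2, h3⟩
  · rw [adjInd_of_not_adj h1, adjInd_of_adj h2, adjInd_of_adj h3, adjInd_of_not_adj h4]
    norm_num
  · by_cases hadj : G.Adj f (σ l)
    · rw [adjInd_of_adj hadj, adjInd_of_adj (h2.mp hadj), adjInd_of_adj (h3 hadj),
        adjInd_of_adj (h1.mp (h3 hadj))]
    · rw [adjInd_of_not_adj hadj, adjInd_of_not_adj fun hh => hadj (h2.mpr hh)]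
      linarith [G.adjInd_nonneg f l, G'.adjInd_nonneg f l]

theorem adjInd_eq (h : IsFoldMove σ ε G G') {u v : V} (hu : ε u ≠ 0) (hv : ε v ≠ 0) :
    G'.adjInd u v = G.adjInd u v :=
  adjInd_congr (h.adj_moved u v hu hv).symm

theorem sign_mate (h : IsFoldMove σ ε G G') {l : V} (hl : ε l = 1) : ε (σ l) = -1 := by
  rw [h.sign, hl]

theorem sign_ne_zero (h : IsFoldMove σ ε G G') {l : V} (hl : ε l = 1) :
    ε l ≠ 0 ∧ ε (σ l) ≠ 0 := by
  rw [h.sign, hl]; decide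

theorem ne_mate (h : IsFoldMove σ ε G G') {l l' : V} (hl : ε l = 1) (hl' : ε l' = 1) :
    l ≠ σ l' := by
  intro he
  have := h.sign_mate hl'
  rw [← he, hl] at this
  exact absurd this (by decide)

/-- Each vertex has at least as many neighbours, counted in both graphs, as its mate. -/
theorem add_adjInd_mate_le (h : IsFoldMove σ ε G G') {l : V} (hl : ε l = 1) (w : V) :
    G'.adjInd (σ l) w + G.adjInd (σ l) w ≤ G'.adjInd l (σ w) + G.adjInd l (σ w) := by
  rcases SignType.trichotomy (ε w) with hw | hw | hw
  · have hw' : ε (σ w) = 1 := by rw [h.sign, hw]; rfl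
    rw [h.adjInd_eq (h.sign_ne_zero hl).2 (by rw [hw]; decide),
      h.adjInd_eq (h.sign_ne_zero hl).1 (by rw [hw']; decide)]
    by_cases hadj : G.Adj (σ l) w
    · rw [adjInd_of_adj hadj,
        adjInd_of_adj (h.adj_reflect l (σ w) hl hw' (by rwa [h.involutive w]))]
    · rw [adjInd_of_not_adj hadj]
      linarith [G.adjInd_nonneg l (σ w)]
  · rw [h.fixed w hw]
    have := h.add_adjInd_le hw hl
    rwa [G.adjInd_comm (σ l), G'.adjInd_comm (σ l), G.adjInd_comm l, G'.adjInd_comm l]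
  · rw [h.adjInd_eq (h.sign_ne_zero hl).2 (h.sign_ne_zero hw).1,
      h.adjInd_eq (h.sign_ne_zero hl).1 (h.sign_ne_zero hw).2]
    by_cases hlw : l = w
    · rw [hlw, G.adjInd_comm (σ w)]
    · rw [adjInd_of_not_adj fun hh => h.not_adj_cross w l hw hl (Ne.symm hlw) hh.symm]
      linarith [G.adjInd_nonneg l (σ w)]

variable [Fintype V]

theorem signlessLapMatrix_add_mate_le (h : IsFoldMove σ ε G G') {l : V} (hl : ε l = 1) :
    G'.signlessLapMatrix (σ l) (σ l) + G.signlessLapMatrix (σ l) (σ l) ≤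
      G'.signlessLapMatrix l l + G.signlessLapMatrix l l := by
  simp only [signlessLapMatrix_apply_self, ← Finset.sum_add_distrib]
  rw [← Equiv.sum_comp h.involutive.toPerm fun w => G'.adjInd l w + G.adjInd l w]
  exact Finset.sum_le_sum fun w _ => h.add_adjInd_mate_le hl w

theorem signlessLapMatrix_add_mate_lt (h : IsFoldMove σ ε G G') {l f : V} (hl : ε l = 1)
    (hf : ε f = 0) (h1 : G.Adj f l) (h2 : ¬ G.Adj f (σ l)) :
    G'.signlessLapMatrix (σ l) (σ l) + G.signlessLapMatrix (σ l) (σ l) <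
      G'.signlessLapMatrix l l + G.signlessLapMatrix l l := by
  simp only [signlessLapMatrix_apply_self, ← Finset.sum_add_distrib]
  rw [← Equiv.sum_comp h.involutive.toPerm fun w => G'.adjInd l w + G.adjInd l w]
  refine Finset.sum_lt_sum (fun w _ => h.add_adjInd_mate_le hl w) ⟨f, Finset.mem_univ _, ?_⟩
  rcases h.adj_mixed f l hf hl with ⟨h3, -⟩ | ⟨h3, h4, -⟩
  · exact absurd h1 h3
  · rw [Function.Involutive.coe_toPerm, h.fixed f hf, adjInd_of_adj h1.symm,
      adjInd_of_adj (h3.mp h1).symm, adjInd_of_not_adj fun hh => h2 hh.symm,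
      adjInd_of_not_adj fun hh => h2 (h4.mpr hh.symm)]
    norm_num

/-- Only edges to fixed vertices change, and each edge lost at `σ l` is gained at `l`. -/
theorem abs_signlessLapMatrix_sub_mate_le (h : IsFoldMove σ ε G G') {l : V} (hl : ε l = 1) :
    |G'.signlessLapMatrix (σ l) (σ l) - G.signlessLapMatrix (σ l) (σ l)| ≤
      G'.signlessLapMatrix l l - G.signlessLapMatrix l l := by
  simp only [signlessLapMatrix_apply_self, ← Finset.sum_sub_distrib]
  refine (Finset.abs_sum_le_sum_abs _ _).trans (Finset.sum_le_sum fun w _ => ?_)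
  by_cases hw : ε w = 0
  · rw [G'.adjInd_comm (σ l), G.adjInd_comm (σ l), G'.adjInd_comm l, G.adjInd_comm l]
    exact h.abs_sub_adjInd_le hw hl
  · rw [h.adjInd_eq (h.sign_ne_zero hl).2 hw, h.adjInd_eq (h.sign_ne_zero hl).1 hw]
    simp

theorem signlessLapMatrix_le_of_fixed (h : IsFoldMove σ ε G G') {f : V} (hf : ε f = 0) :
    G.signlessLapMatrix f f ≤ G'.signlessLapMatrix f f := by
  rw [signlessLapMatrix_apply_self, signlessLapMatrix_apply_self, ← sub_nonneg,
    ← Finset.sum_sub_distrib]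
  -- A loss at `w` is compensated by a gain at `σ w`. Summing over all `w` counts the change of
  -- degree twice.
  have key : ∀ w, 0 ≤ (G'.adjInd f w - G.adjInd f w) +
      (G'.adjInd f (σ w) - G.adjInd f (σ w)) := fun w => by
    rcases SignType.trichotomy (ε w) with hw | hw | hw
    · have hw' : ε (σ w) = 1 := by rw [h.sign, hw]; rfl
      have := (abs_le.mp (h.abs_sub_adjInd_le hf hw')).1
      rw [h.involutive w] at this
      linarith
    · rw [h.fixed w hw]
      by_cases hadj : G.Adj f w
      · rw [adjInd_of_adj hadj, adjInd_of_adj (h.adj_of_fixed f w hf hw hadj)]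
        norm_num
      · rw [adjInd_of_not_adj hadj]
        linarith [G'.adjInd_nonneg f w]
    · have := (abs_le.mp (h.abs_sub_adjInd_le hf hw)).1
      linarith
  have hsum := Finset.sum_nonneg fun w (_ : w ∈ Finset.univ) => key w
  have hcomp := Equiv.sum_comp h.involutive.toPerm fun w => G'.adjInd f w - G.adjInd f w
  simp only [Function.Involutive.coe_toPerm] at hcomp
  rw [Finset.sum_add_distrib, hcomp] at hsum
  linarith

theorem signlessLapMatrix_mixed (h : IsFoldMove σ ε G G') (H : SimpleGraph V) {f l : V}
    (hf : ε f = 0) (hl : ε l = 1) : H.signlessLapMatrix f l = H.adjInd f l ∧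
      H.signlessLapMatrix f (σ l) = H.adjInd f (σ l) := by
  have hne : f ≠ l := by rintro rfl; rw [hf] at hl; exact absurd hl (by decide)
  have hne' : f ≠ σ l := by
    rintro rfl; rw [h.sign_mate hl] at hf; exact absurd hf (by decide)
  exact ⟨signlessLapMatrix_apply_ne _ hne, signlessLapMatrix_apply_ne _ hne'⟩

theorem signlessLapMatrix_moved (h : IsFoldMove σ ε G G') {u v : V} (hu : ε u ≠ 0)
    (hv : ε v ≠ 0) (huv : u ≠ v) : G'.signlessLapMatrix u v = G.signlessLapMatrix u v := by
  rw [signlessLapMatrix_apply_ne _ huv, signlessLapMatrix_apply_ne _ huv, h.adjInd_eq hu hv]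

theorem signlessLapMatrix_cross (h : IsFoldMove σ ε G G') {l l' : V} (hl : ε l = 1)
    (hl' : ε l' = 1) (hne : l ≠ l') : G.signlessLapMatrix l (σ l') = 0 := by
  rw [signlessLapMatrix_apply_ne _ (h.ne_mate hl hl'),
    adjInd_of_not_adj (h.not_adj_cross l l' hl hl' hne)]

theorem signlessLapMatrix_reflect_le (h : IsFoldMove σ ε G G') {l l' : V} (hl : ε l = 1)
    (hl' : ε l' = 1) (hne : l ≠ l') :
    G.signlessLapMatrix (σ l) (σ l') ≤ G.signlessLapMatrix l l' := by
  rw [signlessLapMatrix_apply_ne _ (h.involutive.injective.ne hne),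
    signlessLapMatrix_apply_ne _ hne]
  by_cases hadj : G.Adj (σ l) (σ l')
  · rw [adjInd_of_adj hadj, adjInd_of_adj (h.adj_reflect l l' hl hl' hadj)]
  · rw [adjInd_of_not_adj hadj]
    exact G.adjInd_nonneg l l'

variable [DecidableEq V]

/-- The only possible edges between the two parts join `l` to `σ l`; their entries are dominated by
the degrees on the diagonal. The remaining inequalities say that `l` has at least the neighbours of
`σ l`, up to reflection and counted in both graphs. -/
theorem fold_add_nonneg (h : IsFoldMove σ ε G G') (u v : V) :
    0 ≤ Matrix.fold σ ε (G'.signlessLapMatrix + G.signlessLapMatrix) u v := by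
  refine Matrix.fold_nonneg h.involutive h.sign (fun u v => ?_) (fun f g _ _ => ?_)
    (fun f l hf hl => ?_) (fun l l' hl hl' => ?_) (fun l l' hl hl' => ?_) u v <;>
    simp only [Matrix.add_apply]
  · rw [G.signlessLapMatrix_comm, G'.signlessLapMatrix_comm]
  · exact add_nonneg (G'.signlessLapMatrix_nonneg _ _) (G.signlessLapMatrix_nonneg _ _)
  · rw [(h.signlessLapMatrix_mixed G hf hl).1, (h.signlessLapMatrix_mixed G hf hl).2,
      (h.signlessLapMatrix_mixed G' hf hl).1, (h.signlessLapMatrix_mixed G' hf hl).2,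
      abs_of_nonneg (add_nonneg (G'.adjInd_nonneg _ _) (G.adjInd_nonneg _ _))]
    exact h.add_adjInd_le hf hl
  · rw [G.signlessLapMatrix_comm (σ l) l', G'.signlessLapMatrix_comm (σ l) l']
    rcases eq_or_ne l l' with rfl | hne
    · rw [signlessLapMatrix_apply_ne _ (h.ne_mate hl hl),
        signlessLapMatrix_apply_ne _ (h.ne_mate hl hl), abs_of_nonneg (by
          linarith [G.adjInd_nonneg l (σ l), G'.adjInd_nonneg l (σ l)])]
      have h1 := G.adjInd_le_signlessLapMatrix (σ l) l
      have h2 := G'.adjInd_le_signlessLapMatrix (σ l) l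
      rw [adjInd_comm] at h1 h2
      linarith [G.adjInd_le_signlessLapMatrix l (σ l), G'.adjInd_le_signlessLapMatrix l (σ l)]
    · rw [h.signlessLapMatrix_moved (h.sign_ne_zero hl).1 (h.sign_ne_zero hl').2
          (h.ne_mate hl hl'), h.signlessLapMatrix_moved (h.sign_ne_zero hl').1
          (h.sign_ne_zero hl).2 (h.ne_mate hl' hl), h.signlessLapMatrix_cross hl hl' hne,
        h.signlessLapMatrix_cross hl' hl hne.symm]
      simp only [add_zero, abs_zero]
      linarith [G.signlessLapMatrix_nonneg l l', G'.signlessLapMatrix_nonneg l l',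
        G.signlessLapMatrix_nonneg (σ l) (σ l'), G'.signlessLapMatrix_nonneg (σ l) (σ l')]
  · rw [G.signlessLapMatrix_comm (σ l) l', G'.signlessLapMatrix_comm (σ l) l']
    rcases eq_or_ne l l' with rfl | hne
    · rw [sub_self, abs_zero]
      linarith [h.signlessLapMatrix_add_mate_le hl]
    · rw [h.signlessLapMatrix_moved (h.sign_ne_zero hl).1 (h.sign_ne_zero hl').2
          (h.ne_mate hl hl'), h.signlessLapMatrix_moved (h.sign_ne_zero hl').1
          (h.sign_ne_zero hl).2 (h.ne_mate hl' hl), h.signlessLapMatrix_cross hl hl' hne,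
        h.signlessLapMatrix_cross hl' hl hne.symm,
        h.signlessLapMatrix_moved (h.sign_ne_zero hl).1 (h.sign_ne_zero hl').1 hne,
        h.signlessLapMatrix_moved (h.sign_ne_zero hl).2 (h.sign_ne_zero hl').2
          (h.involutive.injective.ne hne)]
      simp only [add_zero, sub_zero, abs_zero]
      linarith [h.signlessLapMatrix_reflect_le hl hl' hne]

/-- Among the vertices with nonzero sign only the diagonal changes, so the block conditions reduce
to `abs_signlessLapMatrix_sub_mate_le`. -/
theorem fold_sub_nonneg (h : IsFoldMove σ ε G G') (u v : V) :
    0 ≤ Matrix.fold σ ε (G'.signlessLapMatrix - G.signlessLapMatrix) u v := by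
  refine Matrix.fold_nonneg h.involutive h.sign (fun u v => ?_) (fun f g hf hg => ?_)
    (fun f l hf hl => ?_) (fun l l' hl hl' => ?_) (fun l l' hl hl' => ?_) u v <;>
    simp only [Matrix.sub_apply]
  · rw [G.signlessLapMatrix_comm, G'.signlessLapMatrix_comm]
  · rw [sub_nonneg]
    rcases eq_or_ne f g with rfl | hne
    · exact h.signlessLapMatrix_le_of_fixed hf
    · rw [signlessLapMatrix_apply_ne _ hne, signlessLapMatrix_apply_ne _ hne]
      by_cases hadj : G.Adj f g
      · rw [adjInd_of_adj hadj, adjInd_of_adj (h.adj_of_fixed f g hf hg hadj)]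
      · rw [adjInd_of_not_adj hadj]
        exact G'.adjInd_nonneg f g
  · rw [(h.signlessLapMatrix_mixed G hf hl).1, (h.signlessLapMatrix_mixed G hf hl).2,
      (h.signlessLapMatrix_mixed G' hf hl).1, (h.signlessLapMatrix_mixed G' hf hl).2]
    exact h.abs_sub_adjInd_le hf hl
  all_goals
    rw [h.signlessLapMatrix_moved (h.sign_ne_zero hl).1 (h.sign_ne_zero hl').2
        (h.ne_mate hl hl'), h.signlessLapMatrix_moved (h.sign_ne_zero hl).2
        (h.sign_ne_zero hl').1 (h.ne_mate hl' hl).symm]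
    rcases eq_or_ne l l' with rfl | hne
    · have := abs_le.mp (h.abs_signlessLapMatrix_sub_mate_le hl)
      simp only [sub_self, add_zero, abs_zero]
      linarith [this.1, this.2]
    · rw [h.signlessLapMatrix_moved (h.sign_ne_zero hl).1 (h.sign_ne_zero hl').1 hne,
        h.signlessLapMatrix_moved (h.sign_ne_zero hl).2 (h.sign_ne_zero hl').2
          (h.involutive.injective.ne hne)]
      simp

/-- A fold move increases the signless Laplacian Estrada index as soon as an edge really moves
and the reflection does not preserve degrees along some path starting at the moved edge. -/
theorem SLEE_lt (h : IsFoldMove σ ε G G') {s l m f : V} (hs : ε s = 0) (hl : ε l = 1)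
    (hsl : ¬ G.Adj s l) (hsr : G.Adj s (σ l))
    (hpath : Relation.ReflTransGen
      (fun a b => ε a = 1 ∧ ε b = 1 ∧ G.Adj a b ∧ G.Adj (σ a) (σ b)) l m)
    (hm : ε m = 1) (hf : ε f = 0) (hfm : G.Adj f m) (hfm' : ¬ G.Adj f (σ m)) :
    G.SLEE < G'.SLEE := by
  set P := (1 / 2 : ℝ) • Matrix.fold σ ε (G'.signlessLapMatrix + G.signlessLapMatrix) with hPdef
  set R := (1 / 2 : ℝ) • Matrix.fold σ ε (G'.signlessLapMatrix - G.signlessLapMatrix) with hRdef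
  have hP : ∀ i j, 0 ≤ P i j := fun i j =>
    mul_nonneg (by norm_num) (h.fold_add_nonneg i j)
  have hR : ∀ i j, 0 ≤ R i j := fun i j =>
    mul_nonneg (by norm_num) (h.fold_sub_nonneg i j)
  have hadd : P + R = Matrix.fold σ ε G'.signlessLapMatrix := by
    rw [hPdef, hRdef, Matrix.fold_add, Matrix.fold_sub]; module
  have hsub : P - R = Matrix.fold σ ε G.signlessLapMatrix := by
    rw [hPdef, hRdef, Matrix.fold_add, Matrix.fold_sub]; module
  have hPpos : ∀ {i j}, 0 < Matrix.fold σ ε (G'.signlessLapMatrix + G.signlessLapMatrix) i j →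
      0 < P i j := fun hij => mul_pos (by norm_num) hij
  have htr := fun X k => Matrix.trace_fold_pow h.involutive h.sign h.fixed X k
  obtain ⟨-, hsl', -, hsr'⟩ := (h.adj_mixed s l hs hl).resolve_right
    fun hh => hsl (hh.2.2 hsr)
  -- The closed walk sought is `s, l, …, m, σ m, …, σ l, s`: out along symmetric vectors, back along
  -- antisymmetric ones, with `R` used only in the last step.
  have hpath1 : Relation.ReflTransGen (fun i j => 0 < P i j) l m ∧
      Relation.ReflTransGen (fun i j => 0 < P i j) (σ m) (σ l) := by
    clear hm hfm hfm'
    induction hpath with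
    | refl => exact ⟨.refl, .refl⟩
    | @tail a b _ hab ih =>
      obtain ⟨ha, hb, hab, hab'⟩ := hab
      have hba := adjInd_of_adj hab.symm
      have hba' := adjInd_of_adj hab'.symm
      have hne := hab.ne
      rw [adjInd_comm] at hba
      refine ⟨ih.1.tail (hPpos ?_), ih.2.head (hPpos ?_)⟩
      · rw [Matrix.fold_apply, ha, hb]
        simp only [Matrix.foldSelf_one, Matrix.foldMate_one, Matrix.add_apply]
        have h1 : 0 < G.signlessLapMatrix a b := by
          rw [signlessLapMatrix_apply_ne _ hne, hba]; norm_num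
        linarith [G'.signlessLapMatrix_nonneg a b, G.signlessLapMatrix_nonneg a (σ b),
          G'.signlessLapMatrix_nonneg a (σ b), G.signlessLapMatrix_nonneg (σ a) b,
          G'.signlessLapMatrix_nonneg (σ a) b, G.signlessLapMatrix_nonneg (σ a) (σ b),
          G'.signlessLapMatrix_nonneg (σ a) (σ b)]
      · rw [Matrix.fold_apply, h.sign_mate ha, h.sign_mate hb, h.involutive a, h.involutive b]
        simp only [Matrix.foldSelf_neg_one, Matrix.foldMate_neg_one, Matrix.add_apply]
        rw [G.signlessLapMatrix_comm (σ b) a, G'.signlessLapMatrix_comm (σ b) a,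
          h.signlessLapMatrix_moved (h.sign_ne_zero ha).1 (h.sign_ne_zero hb).2
            (h.ne_mate ha hb), h.signlessLapMatrix_moved (h.sign_ne_zero hb).1
            (h.sign_ne_zero ha).2 (h.ne_mate hb ha), h.signlessLapMatrix_cross ha hb hne,
          h.signlessLapMatrix_cross hb ha hne.symm]
        have h1 : 0 < G.signlessLapMatrix (σ b) (σ a) := by
          rw [signlessLapMatrix_apply_ne _ (h.involutive.injective.ne hne.symm), hba']; norm_num
        linarith [G'.signlessLapMatrix_nonneg (σ b) (σ a), G.signlessLapMatrix_nonneg b a,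
          G'.signlessLapMatrix_nonneg b a]
  have hstart : 0 < P s l := by
    refine hPpos ?_
    rw [Matrix.fold_apply, hs, hl]
    simp only [Matrix.foldSelf_zero, Matrix.foldMate_zero, Matrix.foldSelf_one,
      Matrix.foldMate_one, Matrix.add_apply]
    rw [(h.signlessLapMatrix_mixed G hs hl).1, (h.signlessLapMatrix_mixed G hs hl).2,
      (h.signlessLapMatrix_mixed G' hs hl).1, (h.signlessLapMatrix_mixed G' hs hl).2,
      adjInd_of_adj hsl', adjInd_of_adj hsr, adjInd_of_not_adj hsl, adjInd_of_not_adj hsr']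
    norm_num
  -- The entry of `P` between the symmetric and the antisymmetric vector of a pair is a positive
  -- multiple of the difference of degrees of `m` and `σ m`, summed over both graphs; the vertex `f`
  -- makes it positive.
  have hcross : 0 < P m (σ m) := by
    refine hPpos ?_
    rw [Matrix.fold_apply, hm, h.sign_mate hm, h.involutive m]
    simp only [Matrix.foldSelf_neg_one, Matrix.foldMate_neg_one, Matrix.foldSelf_one,
      Matrix.foldMate_one, Matrix.add_apply]
    rw [G.signlessLapMatrix_comm (σ m) m, G'.signlessLapMatrix_comm (σ m) m]
    linarith [h.signlessLapMatrix_add_mate_lt hm hf hfm hfm']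
  have hend : 0 < R (σ l) s := by
    refine mul_pos (by norm_num) ?_
    rw [Matrix.fold_apply, hs, h.sign_mate hl, h.involutive l]
    simp only [Matrix.foldSelf_neg_one, Matrix.foldMate_neg_one, Matrix.foldSelf_zero,
      Matrix.foldMate_zero, Matrix.sub_apply]
    rw [G.signlessLapMatrix_comm (σ l) s, G'.signlessLapMatrix_comm (σ l) s,
      G.signlessLapMatrix_comm l s, G'.signlessLapMatrix_comm l s,
      (h.signlessLapMatrix_mixed G hs hl).1, (h.signlessLapMatrix_mixed G hs hl).2,
      (h.signlessLapMatrix_mixed G' hs hl).1, (h.signlessLapMatrix_mixed G' hs hl).2,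
      adjInd_of_adj hsl', adjInd_of_adj hsr, adjInd_of_not_adj hsl, adjInd_of_not_adj hsr']
    norm_num
  refine SLEE_lt_of_trace_pow_le (fun k => ?_) ?_
  · have := Matrix.trace_sub_pow_le_trace_add_pow hP hR k
    rwa [hadd, hsub, htr, htr] at this
  · have := Matrix.exists_trace_sub_pow_lt_trace_add_pow hP hR
      (((Relation.ReflTransGen.head (r := fun i j => 0 < P i j) hstart hpath1.1).tail hcross).trans
        hpath1.2) hend
    simpa only [hadd, hsub, htr] using this

end IsFoldMove

end SimpleGraph

/-! ### Level graphs as the edge-maximal graphs of given diameter. -/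

namespace SimpleGraph

variable {V : Type*}

/-- The graph in which two distinct vertices are adjacent when their levels differ by at most
one. -/
def levelGraph (lev : V → ℕ) : SimpleGraph V where
  Adj u v := u ≠ v ∧ lev u ≤ lev v + 1 ∧ lev v ≤ lev u + 1
  symm := ⟨fun _ _ h => ⟨h.1.symm, h.2.2, h.2.1⟩⟩
  loopless := ⟨fun _ h => h.1 rfl⟩

/-- A level function taking exactly the values `0, …, d`. -/
structure IsLevelling (lev : V → ℕ) (d : ℕ) : Prop where
  le : ∀ v, lev v ≤ d
  surj : ∀ i ≤ d, ∃ v, lev v = i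

theorem levelGraph_adj {lev : V → ℕ} {u v : V} :
    (levelGraph lev).Adj u v ↔ u ≠ v ∧ lev u ≤ lev v + 1 ∧ lev v ≤ lev u + 1 := Iff.rfl

theorem Walk.lev_le_add_length {lev : V → ℕ} {u v : V} (p : (levelGraph lev).Walk u v) :
    lev v ≤ lev u + p.length := by
  induction p with
  | nil => simp
  | cons h _ ih =>
    have := h.2.2
    rw [Walk.length_cons]
    omega

namespace IsLevelling

variable {lev : V → ℕ} {d : ℕ}

/-- The bound is `max 1 k` because distinct vertices of one level are still at distance one. -/
theorem exists_walk_length_le (h : IsLevelling lev d) (k : ℕ) (u v : V) (huv : lev u ≤ lev v)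
    (hk : lev v ≤ lev u + k) : ∃ p : (levelGraph lev).Walk u v, p.length ≤ max 1 k := by
  have key : ∀ w, lev u ≤ lev w → lev w ≤ lev u + 1 →
      ∃ p : (levelGraph lev).Walk u w, p.length ≤ 1 := fun w h1 h2 => by
    by_cases hne : u = w
    · subst hne; exact ⟨.nil, by simp⟩
    · exact ⟨(levelGraph_adj.mpr ⟨hne, by omega, h2⟩).toWalk, by simp⟩
  induction k generalizing v with
  | zero =>
    obtain ⟨p, hp⟩ := key v (by omega) (by omega)
    exact ⟨p, by omega⟩
  | succ k ih =>
    by_cases h1 : lev v ≤ lev u + 1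
    · obtain ⟨p, hp⟩ := key v (by omega) h1
      exact ⟨p, by omega⟩
    · have hd := h.le v
      obtain ⟨w, hw⟩ := h.surj (lev v - 1) (by omega)
      obtain ⟨p, hp⟩ := ih w (by omega) (by omega)
      have hadj : (levelGraph lev).Adj w v :=
        ⟨fun he => by rw [he] at hw; omega, by omega, by omega⟩
      refine ⟨p.concat hadj, ?_⟩
      rw [Walk.length_concat]
      omega

theorem exists_walk_length_le_diam (h : IsLevelling lev d) (hd : 0 < d) (u v : V) :
    ∃ p : (levelGraph lev).Walk u v, p.length ≤ d := by
  have hu := h.le u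
  have hv := h.le v
  rcases le_total (lev u) (lev v) with huv | huv
  · obtain ⟨p, hp⟩ := h.exists_walk_length_le d u v huv (by omega)
    exact ⟨p, by omega⟩
  · obtain ⟨p, hp⟩ := h.exists_walk_length_le d v u huv (by omega)
    exact ⟨p.reverse, by rw [Walk.length_reverse]; omega⟩

theorem connected (h : IsLevelling lev d) (hd : 0 < d) : (levelGraph lev).Connected :=
  have : Nonempty V := ⟨(h.surj 0 (by omega)).choose⟩
  ⟨fun u v => ⟨(h.exists_walk_length_le_diam hd u v).choose⟩⟩

theorem diam_eq [Finite V] (h : IsLevelling lev d) (hd : 0 < d) :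
    (levelGraph lev).diam = d := by
  have hconn := h.connected hd
  have := hconn.nonempty
  refine le_antisymm ?_ ?_
  · obtain ⟨u, v, huv⟩ := (levelGraph lev).exists_dist_eq_diam
    obtain ⟨p, hp⟩ := h.exists_walk_length_le_diam hd u v
    rw [← huv]
    exact (dist_le p).trans hp
  · obtain ⟨u, hu⟩ := h.surj 0 (by omega)
    obtain ⟨v, hv⟩ := h.surj d le_rfl
    obtain ⟨p, hp⟩ := hconn.exists_walk_length_eq_dist u v
    have h1 := p.lev_le_add_length
    have h2 : (levelGraph lev).dist u v ≤ (levelGraph lev).diam :=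
      dist_le_diam (connected_iff_ediam_ne_top.mp hconn)
    omega

/-- Reversing the levels. -/
theorem reverse (h : IsLevelling lev d) : IsLevelling (fun v => d - lev v) d where
  le v := Nat.sub_le _ _
  surj i hi := by
    obtain ⟨v, hv⟩ := h.surj (d - i) (Nat.sub_le _ _)
    exact ⟨v, by omega⟩

theorem levelGraph_reverse (h : IsLevelling lev d) :
    levelGraph (fun v => d - lev v) = levelGraph lev := by
  ext u v
  have := h.le u
  have := h.le v
  simp only [levelGraph_adj]
  refine and_congr_right fun _ => ?_
  omega

end IsLevelling

/-- A connected graph of diameter `d` is contained in the level graph of the distances from an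
endpoint of a diametral path. -/
theorem exists_isLevelling_le [Finite V] {G : SimpleGraph V} (hG : G.Connected) :
    ∃ lev : V → ℕ, IsLevelling lev G.diam ∧ G ≤ levelGraph lev := by
  have := hG.nonempty
  obtain ⟨u, v, huv⟩ := G.exists_dist_eq_diam
  refine ⟨fun w => G.dist u w, ⟨fun w => dist_le_diam (connected_iff_ediam_ne_top.mp hG),
    fun i hi => ?_⟩, fun a b hab => ⟨hab.ne, ?_, ?_⟩⟩
  · obtain ⟨p, hp⟩ := hG.exists_walk_length_eq_dist u v
    rw [← huv, ← hp] at hi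
    refine ⟨p.getVert i, le_antisymm ?_ ?_⟩
    · have := dist_le (p.take i)
      rw [Walk.take_length] at this
      omega
    · have h1 := dist_le (p.drop i)
      rw [Walk.drop_length] at h1
      have h2 := hG.dist_triangle (u := u) (v := p.getVert i) (w := v)
      omega
  · have h1 := hG.dist_triangle (u := u) (v := b) (w := a)
    rw [dist_eq_one_iff_adj.mpr hab.symm] at h1
    exact h1
  · have h1 := hG.dist_triangle (u := u) (v := a) (w := b)
    rw [dist_eq_one_iff_adj.mpr hab] at h1
    exact h1

namespace IsLevelling

variable {lev : V → ℕ} {d : ℕ}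

open Classical in
/-- Moving a whole level `q`, except for one vertex `b`, one level down. -/
noncomputable def _root_.SimpleGraph.lowerLevel (lev : V → ℕ) (q : ℕ) (b v : V) : ℕ :=
  if lev v = q ∧ v ≠ b then q - 1 else lev v

theorem lowerLevel (h : IsLevelling lev d) {q : ℕ} {b : V} (hb : lev b = q) :
    IsLevelling (SimpleGraph.lowerLevel lev q b) d where
  le v := by
    have := h.le v
    unfold SimpleGraph.lowerLevel
    split_ifs with hv <;> omega
  surj i hi := by
    by_cases hiq : i = q
    · exact ⟨b, by simp [SimpleGraph.lowerLevel, hb, hiq]⟩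
    · obtain ⟨v, hv⟩ := h.surj i hi
      refine ⟨v, ?_⟩
      rw [SimpleGraph.lowerLevel, if_neg (by omega), hv]

theorem lowerLevel_cases (lev : V → ℕ) (q : ℕ) (b v : V) :
    (lev v = q ∧ v ≠ b ∧ SimpleGraph.lowerLevel lev q b v = q - 1) ∨
      ((lev v ≠ q ∨ v = b) ∧ SimpleGraph.lowerLevel lev q b v = lev v) := by
  unfold SimpleGraph.lowerLevel
  split_ifs with h
  · exact .inl ⟨h.1, h.2, rfl⟩
  · exact .inr ⟨by tauto, rfl⟩

/-- There is no level above `d` to lose edges to, while `s` gains its edges to level `d - 2`. -/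
theorem levelGraph_lt_lowerLevel (h : IsLevelling lev d) (hd : 2 ≤ d) {b s : V}
    (hb : lev b = d) (hs : lev s = d) (hsb : s ≠ b) :
    levelGraph lev < levelGraph (SimpleGraph.lowerLevel lev d b) := by
  refine lt_of_le_of_ne (fun u v huv => ?_) fun he => ?_
  · rw [levelGraph_adj] at huv ⊢
    have := h.le u
    have := h.le v
    refine ⟨huv.1, ?_⟩
    rcases lowerLevel_cases lev d b u with ⟨_, _, hu⟩ | ⟨_, hu⟩ <;>
      rcases lowerLevel_cases lev d b v with ⟨_, _, hv⟩ | ⟨_, hv⟩ <;> omega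
  · obtain ⟨w, hw⟩ := h.surj (d - 2) (by omega)
    have h1 : ¬ (levelGraph lev).Adj s w := fun hh => by
      rw [levelGraph_adj] at hh; omega
    rw [he] at h1
    refine h1 ⟨fun hh => by rw [hh] at hs; omega, ?_⟩
    rcases lowerLevel_cases lev d b s with ⟨_, _, hu⟩ | ⟨hu', hu⟩
    · rcases lowerLevel_cases lev d b w with ⟨_, _, hv⟩ | ⟨_, hv⟩ <;> omega
    · exact absurd hu' (by simp [hs, hsb])

/-! ### Lowering a level as a fold move. -/

section Reflection

/- `rep` chooses a vertex in each level; the reflection exchanges the levels `i` and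
`2 * q - 1 - i` of the chosen path. -/

variable (lev d) (q : ℕ) (rep : ℕ → V)

/-- The chosen path vertices which have a mirror image under `i ↦ 2 * q - 1 - i`. -/
def OnPath (v : V) : Prop := v = rep (lev v) ∧ 2 * q ≤ lev v + d + 1

open Classical in
/-- The reflection `rep i ↔ rep (2 * q - 1 - i)`. -/
noncomputable def reflection (v : V) : V :=
  if OnPath lev d q rep v then rep (2 * q - 1 - lev v) else v

open Classical in
/-- The sign distinguishing the lower part, the upper part and the fixed part. -/
noncomputable def reflectionSign (v : V) : SignType :=
  if OnPath lev d q rep v then if lev v < q then 1 else -1 else 0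

variable {lev d q rep}

theorem reflectionSign_eq_zero {v : V} :
    reflectionSign lev d q rep v = 0 ↔ ¬ OnPath lev d q rep v := by
  unfold reflectionSign
  split_ifs <;> simp_all

theorem reflectionSign_eq_one {v : V} :
    reflectionSign lev d q rep v = 1 ↔ OnPath lev d q rep v ∧ lev v < q := by
  unfold reflectionSign
  split_ifs with h1 h2 <;> simp_all

theorem reflection_of_onPath {v : V} (hv : OnPath lev d q rep v) :
    reflection lev d q rep v = rep (2 * q - 1 - lev v) := if_pos hv

theorem reflection_of_not_onPath {v : V} (hv : ¬ OnPath lev d q rep v) :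
    reflection lev d q rep v = v := if_neg hv

theorem onPath_rep (hrep : ∀ i ≤ d, lev (rep i) = i) {i : ℕ} (hi : i ≤ d)
    (hiq : 2 * q ≤ i + d + 1) : OnPath lev d q rep (rep i) := by
  rw [OnPath, hrep i hi]
  exact ⟨rfl, hiq⟩

theorem onPath_reflection (h : IsLevelling lev d) (hdq : d + 1 ≤ 2 * q)
    (hrep : ∀ i ≤ d, lev (rep i) = i) {v : V} (hv : OnPath lev d q rep v) :
    OnPath lev d q rep (reflection lev d q rep v) ∧
      lev (reflection lev d q rep v) = 2 * q - 1 - lev v := by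
  have hle := h.le v
  have hge := hv.2
  have hid : 2 * q - 1 - lev v ≤ d := by omega
  rw [reflection_of_onPath hv]
  exact ⟨onPath_rep hrep hid (by omega), hrep _ hid⟩

theorem reflection_involutive (h : IsLevelling lev d) (hdq : d + 1 ≤ 2 * q)
    (hrep : ∀ i ≤ d, lev (rep i) = i) : Function.Involutive (reflection lev d q rep) := fun v => by
  by_cases hv : OnPath lev d q rep v
  · obtain ⟨h1, h2⟩ := onPath_reflection h hdq hrep hv
    have := h.le v
    rw [reflection_of_onPath h1, h2, show 2 * q - 1 - (2 * q - 1 - lev v) = lev v by omega]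
    exact hv.1.symm
  · rw [reflection_of_not_onPath hv, reflection_of_not_onPath hv]

theorem reflectionSign_reflection (h : IsLevelling lev d) (hdq : d + 1 ≤ 2 * q)
    (hrep : ∀ i ≤ d, lev (rep i) = i) (v : V) :
    reflectionSign lev d q rep (reflection lev d q rep v) = -reflectionSign lev d q rep v := by
  by_cases hv : OnPath lev d q rep v
  · obtain ⟨h1, h2⟩ := onPath_reflection h hdq hrep hv
    have := h.le v
    rw [reflectionSign, reflectionSign, if_pos h1, if_pos hv, h2]
    by_cases hq : lev v < q
    · rw [if_neg (by omega), if_pos hq]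
    · rw [if_pos (by omega), if_neg hq]; rfl
  · rw [reflection_of_not_onPath hv, reflectionSign_eq_zero.mpr hv]; rfl

/-- Since the levels above `q` are singletons, a vertex fixed by the reflection lies either below
level `q` and stays, or in level `q` and is lowered. A lowered vertex trades level `q + 1` for its
mirror level `q - 2`; the levels `q` and `q - 1`, mirror images of each other, remain adjacent to
it. -/
theorem isFoldMove (h : IsLevelling lev d) (hdq : d + 1 ≤ 2 * q) (hqd : q ≤ d)
    (hrep : ∀ i ≤ d, lev (rep i) = i)
    (hsing : ∀ u v, q < lev u → lev u = lev v → u = v) :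
    IsFoldMove (reflection lev d q rep) (reflectionSign lev d q rep) (levelGraph lev)
      (levelGraph (SimpleGraph.lowerLevel lev q (rep q))) := by
  have hfix : ∀ f, reflectionSign lev d q rep f = 0 →
      (lev f < q ∧ SimpleGraph.lowerLevel lev q (rep q) f = lev f) ∨
        (lev f = q ∧ SimpleGraph.lowerLevel lev q (rep q) f = q - 1) := fun f hf => by
    rw [reflectionSign_eq_zero] at hf
    have hle := h.le f
    rcases lowerLevel_cases lev q (rep q) f with ⟨h1, _, h2⟩ | ⟨h1, h2⟩
    · exact .inr ⟨h1, h2⟩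
    · refine .inl ⟨?_, h2⟩
      by_contra hlt
      refine hf ⟨?_, by omega⟩
      rcases eq_or_ne (lev f) q with hq | hq
      · rw [hq]; exact h1.resolve_left (not_not.mpr hq)
      · exact hsing _ _ (by omega) (hrep _ hle).symm
  have hpath : ∀ v, OnPath lev d q rep v →
      SimpleGraph.lowerLevel lev q (rep q) v = lev v := fun v hv => by
    rcases lowerLevel_cases lev q (rep q) v with ⟨h1, h2, _⟩ | ⟨_, h2⟩
    · exact absurd (h1 ▸ hv.1) h2
    · exact h2
  have hmate : ∀ l, reflectionSign lev d q rep l = 1 → OnPath lev d q rep l ∧ lev l < q ∧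
      OnPath lev d q rep (reflection lev d q rep l) ∧
      lev (reflection lev d q rep l) = 2 * q - 1 - lev l := fun l hl => by
    obtain ⟨h1, h2⟩ := reflectionSign_eq_one.mp hl
    exact ⟨h1, h2, onPath_reflection h hdq hrep h1⟩
  refine ⟨reflection_involutive h hdq hrep, reflectionSign_reflection h hdq hrep,
    fun v hv => reflection_of_not_onPath (reflectionSign_eq_zero.mp hv), ?_, ?_, ?_, ?_, ?_⟩
  · intro f g hf hg hfg
    rw [levelGraph_adj] at hfg ⊢
    refine ⟨hfg.1, ?_⟩
    rcases hfix f hf with hf | hf <;> rcases hfix g hg with hg | hg <;> omega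
  · intro f l hf hl
    obtain ⟨h1, h2, h3, h4⟩ := hmate l hl
    have hne : f ≠ l := by
      rintro rfl; exact reflectionSign_eq_zero.mp hf h1
    have hne' : f ≠ reflection lev d q rep l := by
      intro he; rw [he] at hf; exact reflectionSign_eq_zero.mp hf h3
    simp only [levelGraph_adj, ne_eq, hne, hne', not_false_eq_true, true_and, hpath _ h1,
      hpath _ h3, h4]
    rcases hfix f hf with ⟨hf, hf'⟩ | ⟨hf, hf'⟩ <;> rw [hf'] <;> omega
  · intro u v hu hv
    rw [ne_eq, reflectionSign_eq_zero, not_not] at hu hv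
    rw [levelGraph_adj, levelGraph_adj, hpath u hu, hpath v hv]
  · intro l l' hl hl' hadj
    obtain ⟨-, h2, -, h4⟩ := hmate l hl
    obtain ⟨-, h2', -, h4'⟩ := hmate l' hl'
    rw [levelGraph_adj, h4, h4'] at hadj
    exact ⟨fun he => hadj.1 (by rw [he]), by omega, by omega⟩
  · intro l l' hl hl' hne hadj
    obtain ⟨h1, h2, -, -⟩ := hmate l hl
    obtain ⟨h1', h2', -, h4'⟩ := hmate l' hl'
    rw [levelGraph_adj, h4'] at hadj
    have : lev l = lev l' := by omega
    exact hne (by rw [h1.1, h1'.1, this])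

end Reflection

/-- If all levels above `q` are singletons and `q` lies in the upper half, then moving the
level `q` except for one vertex one level down increases the signless Laplacian Estrada
index. -/
theorem exists_SLEE_lt [Fintype V] (h : IsLevelling lev d) (hd : 2 < d) {q : ℕ}
    (hsing : ∀ u v, q < lev u → lev u = lev v → u = v) {b s : V} (hb : lev b = q)
    (hs : lev s = q) (hsb : s ≠ b)
    (hq : d + 1 < 2 * q ∨
      (d + 1 = 2 * q ∧ ∃ a a', a ≠ a' ∧ lev a + 1 = q ∧ lev a' + 1 = q)) :
    ∃ lev' : V → ℕ, IsLevelling lev' d ∧ (levelGraph lev).SLEE < (levelGraph lev').SLEE := by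
  classical
  refine ⟨_, h.lowerLevel hb, ?_⟩
  have hqd : q ≤ d := hb ▸ h.le b
  -- For `q = d` no edge is lost and plain monotonicity suffices.
  rcases hqd.eq_or_lt with rfl | hqd'
  · exact SLEE_lt_of_lt (h.levelGraph_lt_lowerLevel (by omega) hb hs hsb)
  have hdq : d + 1 ≤ 2 * q := by omega
  obtain ⟨rep, hrep, rfl⟩ : ∃ rep : ℕ → V, (∀ i ≤ d, lev (rep i) = i) ∧ rep q = b := by
    have : ∀ i, ∃ v, i ≤ d → lev v = i := fun i => by
      by_cases hi : i ≤ d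
      · obtain ⟨v, hv⟩ := h.surj i hi
        exact ⟨v, fun _ => hv⟩
      · exact ⟨b, fun hh => absurd hh hi⟩
    choose rep hrep using this
    refine ⟨Function.update rep q b, fun i hi => ?_, Function.update_self ..⟩
    rcases eq_or_ne i q with rfl | hne
    · rw [Function.update_self, hb]
    · rw [Function.update_of_ne hne, hrep i hi]
  have hmove := h.isFoldMove hdq hqd hrep hsing
  have hone : ∀ i < q, 2 * q ≤ i + d + 1 → reflectionSign lev d q rep (rep i) = 1 :=
    fun i hi hi' => reflectionSign_eq_one.mpr
      ⟨onPath_rep hrep (by omega) hi', by rw [hrep i (by omega)]; exact hi⟩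
  have hrefl : ∀ i < q, 2 * q ≤ i + d + 1 →
      reflection lev d q rep (rep i) = rep (2 * q - 1 - i) := fun i hi hi' => by
    rw [reflection_of_onPath (onPath_rep hrep (by omega) hi'), hrep i (by omega)]
  have hne : ∀ {i v}, i ≤ d → lev v ≠ i → v ≠ rep i := fun {i v} hi hv he => hv (by
    rw [he, hrep i hi])
  have hadj : ∀ {i j}, i ≤ d → j ≤ d → i = j + 1 ∨ j = i + 1 →
      (levelGraph lev).Adj (rep i) (rep j) := fun {i j} hi hj hij => by
    refine ⟨hne hj (by rw [hrep i hi]; omega), ?_⟩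
    rw [hrep i hi, hrep j hj]
    omega
  have hpath : ∀ j, 2 * q + j ≤ q - 2 + d + 1 → Relation.ReflTransGen
      (fun a b => reflectionSign lev d q rep a = 1 ∧ reflectionSign lev d q rep b = 1 ∧
        (levelGraph lev).Adj a b ∧
        (levelGraph lev).Adj (reflection lev d q rep a) (reflection lev d q rep b))
      (rep (q - 2)) (rep (q - 2 - j)) := fun j hj => by
    induction j with
    | zero => exact .refl
    | succ j ih =>
      refine (ih (by omega)).tail ⟨hone _ (by omega) (by omega), hone _ (by omega) (by omega),
        hadj (by omega) (by omega) (by omega), ?_⟩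
      rw [hrefl _ (by omega) (by omega), hrefl _ (by omega) (by omega)]
      exact hadj (by omega) (by omega) (by omega)
  have hs0 : reflectionSign lev d q rep s = 0 :=
    reflectionSign_eq_zero.mpr fun hh => hsb (hs ▸ hh.1)
  have hsl : ¬ (levelGraph lev).Adj s (rep (q - 2)) := fun hh => by
    rw [levelGraph_adj, hrep _ (by omega)] at hh; omega
  have hsr : (levelGraph lev).Adj s (reflection lev d q rep (rep (q - 2))) := by
    rw [hrefl _ (by omega) (by omega)]
    refine ⟨hne (by omega) (by omega), ?_⟩
    rw [hrep _ (by omega)]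
    omega
  rcases hq with hq | ⟨hq, a, a', haa', ha, ha'⟩
  -- The mirror image of the top level `d` is level `2q - 1 - d`, which is positive here. The path
  -- vertex just below it has no mirror image and breaks the symmetry of degrees.
  · have hm := hpath (q - 2 - (2 * q - 1 - d)) (by omega)
    rw [show q - 2 - (q - 2 - (2 * q - 1 - d)) = 2 * q - 1 - d by omega] at hm
    refine hmove.SLEE_lt (f := rep (2 * q - 2 - d)) hs0 (hone _ (by omega) (by omega)) hsl hsr hm
      (hone _ (by omega) (by omega)) (reflectionSign_eq_zero.mpr fun hh => ?_)
      (hadj (by omega) (by omega) (by omega)) fun hh => ?_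
    · have := hh.2
      rw [hrep _ (by omega)] at this
      omega
    · rw [hrefl _ (by omega) (by omega), levelGraph_adj, hrep _ (by omega),
        hrep _ (by omega)] at hh
      omega
  -- Now the reflection reverses the whole path. A second vertex in level `q - 1` breaks the
  -- symmetry; without one the move would only produce the reversed graph.
  · obtain ⟨f, hf, hf'⟩ : ∃ f, lev f + 1 = q ∧ f ≠ rep (q - 1) := by
      by_cases hfa : a = rep (q - 1)
      · exact ⟨a', ha', fun hh => haa' (hfa.trans hh.symm)⟩
      · exact ⟨a, ha, hfa⟩
    refine hmove.SLEE_lt (f := f) hs0 (hone _ (by omega) (by omega)) hsl hsr .refl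
      (hone _ (by omega) (by omega)) (reflectionSign_eq_zero.mpr fun hh => hf' ?_)
      ⟨hne (by omega) (by omega), ?_⟩ fun hh => ?_
    · rw [show q - 1 = lev f by omega]; exact hh.1
    · rw [hrep _ (by omega)]
      omega
    · rw [hrefl _ (by omega) (by omega), levelGraph_adj, hrep _ (by omega)] at hh
      omega

end IsLevelling

end SimpleGraph

/-! ### The shape of a maximal graph. -/

namespace SimpleGraph

variable {V : Type*} [Fintype V]

namespace IsLevelling

variable {lev : V → ℕ} {d : ℕ}

/-- Induction downwards from level `d`: once the higher levels are singletons, `exists_SLEE_lt`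
forbids two vertices in the current one. -/
theorem eq_of_lev_eq_of_maximal (h : IsLevelling lev d) (hd : 2 < d)
    (hmax : ∀ lev' : V → ℕ, IsLevelling lev' d → (levelGraph lev').SLEE ≤ (levelGraph lev).SLEE)
    (u v : V) (hu : d + 1 < 2 * lev u) (huv : lev u = lev v) : u = v := by
  have key : ∀ m, ∀ u v, d + 1 < 2 * lev u → d < lev u + m → lev u = lev v → u = v := by
    intro m
    induction m with
    | zero => intro u v _ hm _; have := h.le u; omega
    | succ m ih =>
      intro u v hu hm huv
      by_contra hne
      obtain ⟨lev', h1, h2⟩ := h.exists_SLEE_lt hd (q := lev u)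
        (fun a b ha hab => ih a b (by omega) (by omega) hab) huv.symm rfl hne (.inl hu)
      exact absurd (hmax lev' h1) (not_le.mpr h2)
  exact key (d + 1) u v hu (by omega) huv

/-- A maximal level graph has a single nontrivial level, in the middle. -/
theorem exists_eq_of_lev_eq_of_maximal (h : IsLevelling lev d) (hd : 2 < d)
    (hmax : ∀ lev' : V → ℕ, IsLevelling lev' d →
      (levelGraph lev').SLEE ≤ (levelGraph lev).SLEE) :
    ∃ lev' : V → ℕ, IsLevelling lev' d ∧ levelGraph lev' = levelGraph lev ∧
      ∀ u v, lev' u ≠ (d + 1) / 2 → lev' u = lev' v → u = v := by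
  have hup := h.eq_of_lev_eq_of_maximal hd hmax
  have hdown : ∀ u v, 2 * lev u + 1 < d → lev u = lev v → u = v := fun u v hu huv =>
    h.reverse.eq_of_lev_eq_of_maximal hd (by rwa [h.levelGraph_reverse]) u v
      (by have := h.le u; omega) (by rw [huv])
  -- For odd `d` there are two middle levels. If the lower one is nontrivial, the balanced case of
  -- `exists_SLEE_lt` makes the upper one a singleton, and reversal exchanges them.
  by_cases hmid : ∃ a a', a ≠ a' ∧ 2 * lev a + 1 = d ∧ 2 * lev a' + 1 = d
  · obtain ⟨a, a', haa', ha, ha'⟩ := hmid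
    refine ⟨_, h.reverse, h.levelGraph_reverse, fun u v hu huv => ?_⟩
    have hlu := h.le u
    have hlv := h.le v
    by_contra hne
    have hu1 : ¬ d + 1 < 2 * lev u := fun hh => hne (hup u v hh (by omega))
    have hu2 : ¬ 2 * lev u + 1 < d := fun hh => hne (hdown u v hh (by omega))
    obtain ⟨lev', h1, h2⟩ := h.exists_SLEE_lt hd (q := lev u)
      (fun a b ha hab => hup a b (by omega) hab) (b := v) (by omega) rfl hne
      (.inr ⟨by omega, a, a', haa', by omega, by omega⟩)
    exact absurd (hmax lev' h1) (not_le.mpr h2)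
  · refine ⟨lev, h, rfl, fun u v hu huv => ?_⟩
    by_contra hne
    have hu1 : ¬ d + 1 < 2 * lev u := fun hh => hne (hup u v hh huv)
    have hu2 : ¬ 2 * lev u + 1 < d := fun hh => hne (hdown u v hh huv)
    exact hmid ⟨u, v, hne, by omega, by omega⟩

/-- One representative per level gives the path. All other vertices lie in the middle level, so they
form a clique joined to exactly the middle three path vertices. -/
theorem nonempty_iso_pathCliqueGraph (h : IsLevelling lev d) {n : ℕ} (hn : Fintype.card V = n)
    (hsing : ∀ u v, lev u ≠ (d + 1) / 2 → lev u = lev v → u = v) :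
    Nonempty (levelGraph lev ≃g pathCliqueGraph n d) := by
  classical
  have : ∀ i : Fin (d + 1), ∃ v, lev v = i := fun i => h.surj i (by omega)
  choose rep hrep using this
  have hinj : Function.Injective rep := fun i j hij => Fin.ext (by rw [← hrep i, ← hrep j, hij])
  have hrest : ∀ v : {v // v ∉ Set.range rep}, lev v = (d + 1) / 2 := fun v => by
    by_contra hv
    have hle := h.le v
    exact v.2 ⟨⟨lev v, by omega⟩, (hsing _ _ hv (hrep ⟨lev v, by omega⟩).symm).symm⟩
  have hcard : Fintype.card {v // v ∉ Set.range rep} = n - d - 1 := by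
    rw [Fintype.card_subtype_compl, hn]
    have : Fintype.card {v // v ∈ Set.range rep} = d + 1 := by
      rw [Fintype.card_congr (Equiv.ofInjective rep hinj).symm, Fintype.card_fin]
    omega
  let e : Fin (d + 1) ⊕ Fin (n - d - 1) ≃ V :=
    (Equiv.sumCongr (Equiv.ofInjective rep hinj) (Fintype.equivFinOfCardEq hcard).symm).trans
      (Equiv.Set.sumCompl (Set.range rep))
  have hl : ∀ i, lev (e (.inl i)) = i := hrep
  have hr : ∀ a, lev (e (.inr a)) = (d + 1) / 2 := fun a =>
    hrest ((Fintype.equivFinOfCardEq hcard).symm a)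
  refine ⟨(RelIso.symm ⟨e, fun {x y} => ?_⟩)⟩
  rw [levelGraph_adj, ne_eq, e.injective.eq_iff]
  rcases x with i | a <;> rcases y with j | b <;> simp only [hl, hr]
  · change _ ↔ (pathGraph (d + 1)).Adj i j
    rw [pathGraph_adj, Sum.inl.injEq, Fin.ext_iff]
    omega
  · change _ ↔ (i : ℕ) + 1 = (d + 1) / 2 ∨ (i : ℕ) = (d + 1) / 2 ∨ (i : ℕ) = (d + 1) / 2 + 1
    simp only [reduceCtorEq, not_false_eq_true, true_and]
    omega
  · change _ ↔ (j : ℕ) + 1 = (d + 1) / 2 ∨ (j : ℕ) = (d + 1) / 2 ∨ (j : ℕ) = (d + 1) / 2 + 1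
    simp only [reduceCtorEq, not_false_eq_true, true_and]
    omega
  · change _ ↔ a ≠ b
    simp

omit [Fintype V] in
/-- A graph isomorphic to a level graph is a level graph. -/
theorem exists_of_iso {W : Type*} (h : IsLevelling lev d) {H : SimpleGraph W}
    (e : H ≃g levelGraph lev) : ∃ lev' : W → ℕ, IsLevelling lev' d ∧ H = levelGraph lev' := by
  refine ⟨fun w => lev (e w), ⟨fun w => h.le _, fun i hi => ?_⟩, ?_⟩
  · obtain ⟨v, hv⟩ := h.surj i hi
    exact ⟨e.symm v, by rw [← hv]; exact congrArg lev (e.apply_symm_apply v)⟩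
  · ext u v
    rw [← e.map_adj_iff, levelGraph_adj, levelGraph_adj, ne_eq, ne_eq, e.injective.eq_iff]

theorem exists_of_lt_card (hd : d < Fintype.card V) : ∃ lev : V → ℕ, IsLevelling lev d := by
  let e := Fintype.equivFin V
  refine ⟨fun v => min (e v : ℕ) d, ⟨fun v => min_le_right _ _, fun i hi => ?_⟩⟩
  refine ⟨e.symm ⟨i, by omega⟩, ?_⟩
  simp [hi]

end IsLevelling

theorem nonempty_iso_pathCliqueGraph_of_maximal {n d : ℕ} (hn : Fintype.card V = n) (hd : 2 < d)
    {G : SimpleGraph V} (hG : G.Connected) (hdiam : G.diam = d)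
    (hmax : ∀ G' : SimpleGraph V, G'.Connected → G'.diam = d → G'.SLEE ≤ G.SLEE) :
    (∃ lev : V → ℕ, IsLevelling lev d ∧ G = levelGraph lev) ∧
      Nonempty (G ≃g pathCliqueGraph n d) := by
  obtain ⟨lev, hlev, hle⟩ := exists_isLevelling_le hG
  rw [hdiam] at hlev
  have heq : G = levelGraph lev := by
    by_contra hne
    exact absurd (hmax _ (hlev.connected (by omega)) (hlev.diam_eq (by omega)))
      (not_le.mpr (SLEE_lt_of_lt (lt_of_le_of_ne hle hne)))
  refine ⟨⟨lev, hlev, heq⟩, ?_⟩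
  subst heq
  obtain ⟨lev', h1, h2, h3⟩ := hlev.exists_eq_of_lev_eq_of_maximal hd fun lev' h' =>
    hmax _ (h'.connected (by omega)) (h'.diam_eq (by omega))
  rw [← h2]
  exact h1.nonempty_iso_pathCliqueGraph hn h3

end SimpleGraph

theorem theorem3p3 {V : Type*} [Fintype V] (n d : ℕ) (hn : Fintype.card V = n)
    (hd : 2 < d) (hdn : d + 1 < n) (G : SimpleGraph V) :
    ((G.Connected ∧ G.diam = d) ∧
        ∀ G' : SimpleGraph V, G'.Connected → G'.diam = d → G'.SLEE ≤ G.SLEE) ↔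
      Nonempty (G ≃g SimpleGraph.pathCliqueGraph n d) := by
  classical
  refine ⟨fun ⟨⟨h1, h2⟩, h3⟩ =>
    (SimpleGraph.nonempty_iso_pathCliqueGraph_of_maximal hn hd h1 h2 h3).2, fun ⟨e⟩ => ?_⟩
  obtain ⟨lev₀, h₀⟩ := SimpleGraph.IsLevelling.exists_of_lt_card (V := V) (d := d) (by omega)
  -- A maximiser `M` exists by finiteness and is isomorphic to `pathCliqueGraph n d`, hence to `G`.
  -- Its levelling, carried over to `G`, yields connectedness and the diameter.
  obtain ⟨M, ⟨hM1, hM2⟩, hM3⟩ := Set.exists_max_image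
    {G' : SimpleGraph V | G'.Connected ∧ G'.diam = d} SimpleGraph.SLEE (Set.toFinite _)
    ⟨_, h₀.connected (by omega), h₀.diam_eq (by omega)⟩
  obtain ⟨⟨lev, hlev, rfl⟩, ⟨f⟩⟩ := SimpleGraph.nonempty_iso_pathCliqueGraph_of_maximal hn hd
    hM1 hM2 fun G' h1 h2 => hM3 G' ⟨h1, h2⟩
  have hGM := e.trans f.symm
  obtain ⟨lev', hlev', rfl⟩ := hlev.exists_of_iso hGM
  refine ⟨⟨hlev'.connected (by omega), hlev'.diam_eq (by omega)⟩, fun G' h1 h2 => ?_⟩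
  rw [SimpleGraph.SLEE_congr hGM]
  exact hM3 G' ⟨h1, h2⟩
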